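/- Let $K$ be a field, $n\in\mathbb N$, $R=K[x_1,\dots,x_n]$, and let $I\subseteq R$ be a symmetric strongly shifted ideal. That is, $I$ is a monomial ideal, it is fixed by all permutations of the variables, and for every $\lambda=(\lambda_1\le\lambda_2\le\cdots\le\lambda_n)\in\mathbb N^n$ with $x^\lambda\in I$ and all $1\le i<j\le n$ with $\lambda_i<\lambda_j$ one has $x^\lambda\,(x_i/x_j)\in I$. Suppose that $I$ is equigenerated, i.e. all its minimal monomial generators $f_1,\dots,f_s$ have the same degree. Let $S=R[T_1,\dots,T_s]$ and consider the surjections of $R$-algebras $$\varphi:S\to\mathcal R(I)=\bigoplus_{k\ge0}I^kt^k\subseteq R[t],\quad T_i\mapsto f_it,\qquad\qquad \varphi':S\to\operatorname{Sym}_R(I),\quad T_i\mapsto f_i,$$ and the surjection of $K$-algebras $$\overline\varphi:K[T_1,\dots,T_s]\to\mathcal F(I)=\mathcal R(I)/(x_1,\dots,x_n)\mathcal R(I),\quad T_i\mapsto \overline{f_it}.$$ Put $\mathcal K=\ker\varphi$, $\mathcal L=\ker\varphi'$ and $\mathcal J=\ker\overline\varphi$. Then: 1. $I$ is of fiber type,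 i.e. $\mathcal K=\mathcal L+\mathcal J S$; 2. with respect to the bigrading of $S$ given by $\deg x_i=(1,0)$ and $\deg T_j=(0,1)$, the ideal $\mathcal K$ is generated by its bihomogeneous elements of bidegrees $(0,k)$, $k\ge 0$, and $(1,1)$. -/

import Mathlib

open MvPolynomial

noncomputable section

namespace SSSI

variable {K : Type*} [Field K] {n : ℕ}

/-- The ideal `I` of `K[x₁, …, xₙ]` is generated by monomials. -/
def IsMonomialIdeal (I : Ideal (MvPolynomial (Fin n) K)) : Prop :=
  ∃ A : Set (Fin n →₀ ℕ), I = Ideal.span ((fun a => monomial a (1 : K)) '' A)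

/-- The ideal `I` is fixed by every permutation of the variables. -/
def IsSymmetric (I : Ideal (MvPolynomial (Fin n) K)) : Prop :=
  ∀ σ : Equiv.Perm (Fin n), I.map (rename σ : MvPolynomial (Fin n) K →ₐ[K] _) = I

/-- `P(I)`: the partitions `λ₁ ≤ ⋯ ≤ λₙ` such that `x^λ ∈ I`. -/
def partitions (I : Ideal (MvPolynomial (Fin n) K)) : Set (Fin n →₀ ℕ) :=
  {l | Monotone l ∧ monomial l (1 : K) ∈ I}

/-- Symmetric strongly shifted ideals. Since `l i < l j` forces `1 ≤ l j`, the exponent vector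
`l - eⱼ + eᵢ` below is the one of the monomial `x^l (xᵢ / xⱼ)`. -/
structure IsSymmetricStronglyShifted (I : Ideal (MvPolynomial (Fin n) K)) : Prop where
  isMonomialIdeal : IsMonomialIdeal I
  isSymmetric : IsSymmetric I
  borel_move : ∀ l ∈ partitions I, ∀ i j : Fin n, i < j → l i < l j →
    monomial (l - Finsupp.single j 1 + Finsupp.single i 1) (1 : K) ∈ I

/-- `G(I)`: the exponent vectors of the minimal monomial generators of a monomial ideal `I`,
i.e. of the monomials in `I` that are minimal with respect to divisibility. -/
def minGens (I : Ideal (MvPolynomial (Fin n) K)) : Set (Fin n →₀ ℕ) :=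
  {a | Minimal (fun b => monomial b (1 : K) ∈ I) a}

theorem monomial_mem_of_minGens {I : Ideal (MvPolynomial (Fin n) K)} (a : minGens I) :
    monomial a.1 (1 : K) ∈ I :=
  Minimal.prop (P := fun b => monomial b (1 : K) ∈ I) a.2

/-- All minimal monomial generators have the same degree. -/
def IsEquigenerated (I : Ideal (MvPolynomial (Fin n) K)) : Prop :=
  ∃ d : ℕ, ∀ a ∈ minGens I, a.degree = d

/-- `S = R[T_a : a ∈ G(I)]`, with `R = K[x₁, …, xₙ]`: one variable for each minimal generator. -/
abbrev PresRing (I : Ideal (MvPolynomial (Fin n) K)) : Type _ :=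
  MvPolynomial (minGens I) (MvPolynomial (Fin n) K)

/-- The surjection `φ : S → R(I) = ⨁ Iᵏ tᵏ ⊆ R[t]`, `T_a ↦ x^a t`. -/
def toRees (I : Ideal (MvPolynomial (Fin n) K)) :
    PresRing I →ₐ[MvPolynomial (Fin n) K] reesAlgebra I :=
  aeval fun a => ⟨Polynomial.monomial 1 (monomial a.1 (1 : K)),
    reesAlgebra.monomial_mem.mpr (by simpa using monomial_mem_of_minGens a)⟩

/-- The surjection `φ' : S → Sym_R(I)`, `T_a ↦ x^a`. -/
def toSym (I : Ideal (MvPolynomial (Fin n) K)) :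
    PresRing I →ₐ[MvPolynomial (Fin n) K] SymmetricAlgebra (MvPolynomial (Fin n) K) I :=
  aeval fun a => SymmetricAlgebra.ι (MvPolynomial (Fin n) K) I ⟨monomial a.1 (1 : K), monomial_mem_of_minGens a⟩

/-- The extension `(x₁, …, xₙ) R(I)` of the homogeneous maximal ideal to the Rees algebra. -/
def maxIdealRees (I : Ideal (MvPolynomial (Fin n) K)) : Ideal (reesAlgebra I) :=
  (idealOfVars (Fin n) K).map
    (algebraMap (MvPolynomial (Fin n) K) (reesAlgebra I))

/-- The fiber cone `F(I) = R(I) / (x₁, …, xₙ) R(I)`. -/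
abbrev FiberCone (I : Ideal (MvPolynomial (Fin n) K)) : Type _ :=
  reesAlgebra I ⧸ maxIdealRees I

/-- The surjection `φ ⊗_R K : K[T_a : a ∈ G(I)] → F(I)`, which sends `T_a` to the class of
`x^a t`. -/
def toFiberCone (I : Ideal (MvPolynomial (Fin n) K)) :
    MvPolynomial (minGens I) K →+* FiberCone I :=
  ((Ideal.Quotient.mk (maxIdealRees I)).comp (toRees I : PresRing I →+* reesAlgebra I)).comp
    (MvPolynomial.map (C : K →+* MvPolynomial (Fin n) K))

/-- The defining ideal `𝒦` of the Rees algebra. -/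
def reesIdeal (I : Ideal (MvPolynomial (Fin n) K)) : Ideal (PresRing I) :=
  RingHom.ker (toRees I)

/-- The defining ideal `ℒ` of the symmetric algebra. -/
def symIdeal (I : Ideal (MvPolynomial (Fin n) K)) : Ideal (PresRing I) :=
  RingHom.ker (toSym I)

/-- The defining ideal `𝒥` of the fiber cone, an ideal of `K[T_a : a ∈ G(I)]`. -/
def fiberIdeal (I : Ideal (MvPolynomial (Fin n) K)) : Ideal (MvPolynomial (minGens I) K) :=
  RingHom.ker (toFiberCone I)

/-- `I` is of fiber type: `𝒦 = ℒ + 𝒥 S`. -/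
def IsFiberType (I : Ideal (MvPolynomial (Fin n) K)) : Prop :=
  reesIdeal I = symIdeal I +
    (fiberIdeal I).map (MvPolynomial.map (σ := minGens I) (C : K →+* MvPolynomial (Fin n) K))

/-- `f ∈ S` is bihomogeneous of bidegree `(d, k)`, where `xᵢ` has bidegree `(1, 0)` and `T_a` has
bidegree `(0, 1)`: it is homogeneous of degree `k` in the variables `T_a`, with coefficients
that are homogeneous of degree `d` in `x₁, …, xₙ`. -/
def IsBihomogeneous {I : Ideal (MvPolynomial (Fin n) K)} (f : PresRing I) (d k : ℕ) : Prop :=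
  f.IsHomogeneous k ∧ ∀ m, (f.coeff m).IsHomogeneous d

end SSSI

end

open MvPolynomial

namespace SSSI

variable {K : Type*} [Field K] {n : ℕ} {I : Ideal (MvPolynomial (Fin n) K)}

/-! The ideal `𝒦` is toric: it is spanned by binomials `x^a T^α - x^b T^β` whose terms have the same
image (`reesIdeal_le_of_binomial_mem`). By `binomial_mem`, these all reduce to fiber binomials `T^α
- T^β` and linear ones `x_i T_u - x_j T_v`. The reduction is by induction on `deg a`. If the
generator products of `α` and `β` differ, they have equal degree, so `α` has the smaller exponent at
some `i` and the larger at some `j`; hence `x_i ∣ x^a` and `x_j ∣ x^b`. On one of the two sides the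
shifting move trades one of these variables for the other, which can then be cancelled. Both claims
follow by choosing the ideal that is to contain the two families. -/

/-- The exponent vector of `∏ x^u` over a multiset of minimal generators. -/
noncomputable def expSum (I : Ideal (MvPolynomial (Fin n) K)) :
    (minGens I →₀ ℕ) →+ (Fin n →₀ ℕ) :=
  Finsupp.weight (fun u : minGens I => u.1)

@[simp]
theorem expSum_single (u : minGens I) (m : ℕ) : expSum I (Finsupp.single u m) = m • u.1 := by
  simp [expSum, Finsupp.weight_single]

theorem degree_expSum {d : ℕ} (hd : ∀ a ∈ minGens I, a.degree = d) (α : minGens I →₀ ℕ) :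
    (expSum I α).degree = d * α.degree := by
  induction α using Finsupp.induction_linear with
  | zero => simp
  | add f g hf hg => simp [hf, hg, mul_add]
  | single u m => simp [hd u.1 u.2, mul_comm]

theorem le_degree_of_monomial_mem {d : ℕ} (hd : ∀ a ∈ minGens I, a.degree = d)
    {a : Fin n →₀ ℕ} (ha : monomial a (1 : K) ∈ I) : d ≤ a.degree := by
  obtain ⟨b, hba, hb⟩ :=
    exists_minimal_le_of_wellFoundedLT (fun b => monomial b (1 : K) ∈ I) a ha
  rw [← hd b hb]
  exact Finsupp.degree_mono hba

theorem mem_minGens_of_degree {d : ℕ} (hd : ∀ a ∈ minGens I, a.degree = d)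
    {a : Fin n →₀ ℕ} (ha : monomial a (1 : K) ∈ I) (had : a.degree = d) : a ∈ minGens I := by
  obtain ⟨b, hba, hb⟩ :=
    exists_minimal_le_of_wellFoundedLT (fun b => monomial b (1 : K) ∈ I) a ha
  obtain ⟨c, rfl⟩ := le_iff_exists_add.mp hba
  have hc : c.degree = 0 := by
    have := hd b hb
    rw [map_add] at had
    omega
  rw [(Finsupp.degree_eq_zero_iff c).mp hc, add_zero]
  exact hb

/-! ### Exchange moves on minimal generators. -/

theorem monomial_mapDomain_mem (hI : IsSymmetric I) (σ : Equiv.Perm (Fin n))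
    {a : Fin n →₀ ℕ} (ha : monomial a (1 : K) ∈ I) :
    monomial (a.mapDomain σ) (1 : K) ∈ I := by
  have := Ideal.mem_map_of_mem (rename σ : MvPolynomial (Fin n) K →ₐ[K] _) ha
  rw [hI σ] at this
  simpa [rename_monomial] using this

/-- The exchange move holds for arbitrary, not necessarily sorted, exponent vectors. -/
theorem IsSymmetricStronglyShifted.monomial_mem_of_lt (hI : IsSymmetricStronglyShifted I)
    {u : Fin n →₀ ℕ} (hu : monomial u (1 : K) ∈ I) {i j : Fin n} (hij : u i < u j) :
    monomial (u - Finsupp.single j 1 + Finsupp.single i 1) (1 : K) ∈ I := by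
  -- The move is assumed only for sorted vectors; symmetry carries `u` to its sorted form and the
  -- result back.
  set σ : Equiv.Perm (Fin n) := Tuple.sort u
  have hl : ∀ k, (u.mapDomain σ.symm) k = u (σ k) := fun k => by
    have := Finsupp.mapDomain_apply σ.symm.injective u (σ k)
    rwa [Equiv.symm_apply_apply] at this
  have hmono : Monotone (u.mapDomain σ.symm) := by
    have := Tuple.monotone_sort u
    intro a b hab
    rw [hl, hl]
    exact this hab
  have hlt : (u.mapDomain σ.symm) (σ.symm i) < (u.mapDomain σ.symm) (σ.symm j) := by
    simpa [hl] using hij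
  have h := hI.borel_move _ ⟨hmono, monomial_mapDomain_mem hI.isSymmetric σ.symm hu⟩
    (σ.symm i) (σ.symm j) (hmono.reflect_lt hlt) hlt
  have h2 := monomial_mapDomain_mem hI.isSymmetric σ h
  suffices heq : u - Finsupp.single j 1 + Finsupp.single i 1 = _ by rwa [heq]
  refine Finsupp.ext fun k => ?_
  have hk := Finsupp.mapDomain_apply σ.injective
    (u.mapDomain σ.symm - Finsupp.single (σ.symm j) 1 + Finsupp.single (σ.symm i) 1) (σ.symm k)
  rw [Equiv.apply_symm_apply] at hk
  rw [hk]
  simp [hl, Finsupp.single_apply]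

/-- The move preserves degree, so by equigeneration it yields a minimal generator again, hence a
relation `x_i T_u - x_j T_v` in `𝒦`. -/
theorem exists_exchange (hI : IsSymmetricStronglyShifted I) {d : ℕ}
    (hd : ∀ a ∈ minGens I, a.degree = d) (u : minGens I) {i j : Fin n} (hij : u.1 i < u.1 j) :
    ∃ v : minGens I, u.1 + Finsupp.single i 1 = v.1 + Finsupp.single j 1 := by
  have hle : Finsupp.single j 1 ≤ u.1 := by
    rw [Finsupp.single_le_iff]
    omega
  have heq : u.1 - Finsupp.single j 1 + Finsupp.single i 1 + Finsupp.single j 1 =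
      u.1 + Finsupp.single i 1 := by
    rw [add_right_comm, tsub_add_cancel_of_le hle]
  refine ⟨⟨_, mem_minGens_of_degree hd
    (hI.monomial_mem_of_lt (monomial_mem_of_minGens u) hij) ?_⟩, heq.symm⟩
  have := congrArg Finsupp.degree heq
  simp only [map_add, Finsupp.degree_single, hd u.1 u.2] at this ⊢
  omega

/-! ### The Rees ideal as a toric ideal. -/

theorem toRees_monomial (α : minGens I →₀ ℕ) (a : Fin n →₀ ℕ) (c : K) :
    (toRees I (monomial α (monomial a c)) : Polynomial (MvPolynomial (Fin n) K)) =
      Polynomial.monomial α.degree (monomial (a + expSum I α) c) := by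
  have key : ∀ α : minGens I →₀ ℕ,
      (toRees I (monomial α 1) : Polynomial (MvPolynomial (Fin n) K)) =
        Polynomial.monomial α.degree (monomial (expSum I α) 1) := by
    intro α
    induction α using Finsupp.induction_linear with
    | zero =>
      rw [map_zero, map_zero, ← C_apply, ← C_apply, Polynomial.monomial_zero_left]
      simp
    | add f g hf hg =>
      rw [← mul_one (1 : MvPolynomial (Fin n) K), ← monomial_mul, map_mul, Subalgebra.coe_mul,
        hf, hg, Polynomial.monomial_mul_monomial, monomial_mul, map_add, map_add, mul_one]
    | single u m =>
      rw [← X_pow_eq_monomial, map_pow, Subalgebra.coe_pow, toRees, aeval_X,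
        Polynomial.monomial_pow]
      simp [monomial_pow]
  have h : monomial α (monomial a c) =
      C (monomial a c) * monomial α (1 : MvPolynomial (Fin n) K) := by simp [C_mul_monomial]
  rw [h, map_mul, Subalgebra.coe_mul, key, ← algebraMap_eq, AlgHom.commutes,
    Subalgebra.coe_algebraMap, ← Polynomial.C_eq_algebraMap, Polynomial.C_mul_monomial,
    monomial_mul, mul_one]

/-- The difference of two monomials with the same image in the Rees algebra. -/
noncomputable def binomial (a b : Fin n →₀ ℕ) (α β : minGens I →₀ ℕ) : PresRing I :=
  monomial α (monomial a 1) - monomial β (monomial b 1)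

theorem toRees_binomial {a b : Fin n →₀ ℕ} {α β : minGens I →₀ ℕ}
    (h : a + expSum I α = b + expSum I β) (hdeg : α.degree = β.degree) :
    toRees I (binomial a b α β) = 0 := by
  apply Subtype.ext
  rw [binomial, map_sub, Subalgebra.coe_sub, toRees_monomial, toRees_monomial, h, hdeg, sub_self]
  rfl

/-- An ideal that contains all binomials of the toric ideal `𝒦` contains `𝒦`. -/
theorem reesIdeal_le_of_binomial_mem {M : Ideal (PresRing I)}
    (hM : ∀ (a b : Fin n →₀ ℕ) (α β : minGens I →₀ ℕ), a + expSum I α = b + expSum I β →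
      α.degree = β.degree → binomial a b α β ∈ M) : reesIdeal I ≤ M := by
  classical
  -- Partial inverse of `φ` modulo `M`: lift `x^c t^k` to any monomial of `S` above it. By `hM` the
  -- choice is immaterial; the value `0` off the image of `φ` is never used.
  let g : ℕ → (Fin n →₀ ℕ) → PresRing I ⧸ M := fun k c =>
    if h : ∃ p : (Fin n →₀ ℕ) × (minGens I →₀ ℕ), p.1 + expSum I p.2 = c ∧ p.2.degree = k
    then Ideal.Quotient.mk M (monomial h.choose.2 (monomial h.choose.1 1)) else 0
  have hg : ∀ (a : Fin n →₀ ℕ) (α : minGens I →₀ ℕ),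
      g α.degree (a + expSum I α) = Ideal.Quotient.mk M (monomial α (monomial a 1)) := by
    intro a α
    have h : ∃ p : (Fin n →₀ ℕ) × (minGens I →₀ ℕ),
        p.1 + expSum I p.2 = a + expSum I α ∧ p.2.degree = α.degree := ⟨(a, α), rfl, rfl⟩
    simp only [g, dif_pos h]
    exact (Ideal.Quotient.eq).mpr (hM _ _ _ _ h.choose_spec.1 h.choose_spec.2)
  let ψ : Polynomial (MvPolynomial (Fin n) K) →ₗ[K] PresRing I ⧸ M :=
    Polynomial.lsum fun k => (basisMonomials (Fin n) K).constr K (g k)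
  have hψ : ∀ k c, ψ (Polynomial.monomial k (monomial c (1 : K))) = g k c := by
    intro k c
    have := (basisMonomials (Fin n) K).constr_basis K (g k) c
    rw [coe_basisMonomials] at this
    simp only [ψ, Polynomial.lsum_apply]
    rw [Polynomial.sum_monomial_index _ _ (by simp)]
    exact this
  have hψφ : ∀ f : PresRing I, ψ (toRees I f : Polynomial (MvPolynomial (Fin n) K)) =
      Ideal.Quotient.mk M f := by
    intro f
    induction f using MvPolynomial.induction_on' with
    | add p q hp hq => rw [map_add, Subalgebra.coe_add, map_add, hp, hq, map_add]
    | monomial α p =>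
      induction p using MvPolynomial.induction_on' with
      | add p q hp hq =>
        rw [map_add (monomial α), map_add, Subalgebra.coe_add, map_add, hp, hq, map_add]
      | monomial a c =>
        have hc : (monomial a c : MvPolynomial (Fin n) K) = c • monomial a 1 := by
          simp [smul_monomial]
        have hc' : monomial α (monomial a c) =
            c • (monomial α (monomial a 1) : PresRing I) := by
          rw [smul_monomial, ← hc]
        have hmk : Ideal.Quotient.mk M (monomial α (monomial a c)) =
            c • Ideal.Quotient.mk M (monomial α (monomial a 1)) := by
          rw [hc']
          rfl
        have hmon : Polynomial.monomial α.degree (monomial (a + expSum I α) c) =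
            c • Polynomial.monomial α.degree
              (monomial (a + expSum I α) 1 : MvPolynomial (Fin n) K) := by
          rw [Polynomial.smul_monomial, smul_monomial, smul_eq_mul, mul_one]
        rw [toRees_monomial, hmk, ← hg, ← hψ, hmon, map_smul]
  intro f hf
  have hf' : toRees I f = 0 := hf
  rw [← Ideal.Quotient.eq_zero_iff_mem, ← hψφ, hf']
  simp

/-- Multiplying a binomial by a monomial. -/
theorem binomial_add_mem {M : Ideal (PresRing I)} {a b : Fin n →₀ ℕ} {α β : minGens I →₀ ℕ}
    (h : binomial a b α β ∈ M) (c : Fin n →₀ ℕ) (γ : minGens I →₀ ℕ) :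
    binomial (c + a) (c + b) (γ + α) (γ + β) ∈ M := by
  have := M.mul_mem_left (monomial γ (monomial c 1)) h
  rw [binomial, mul_sub, monomial_mul, monomial_mul, monomial_mul, monomial_mul] at this
  simpa [binomial] using this

theorem binomial_trans {M : Ideal (PresRing I)} {a b c : Fin n →₀ ℕ} {α β γ : minGens I →₀ ℕ}
    (h : binomial a b α β ∈ M) (h' : binomial b c β γ ∈ M) : binomial a c α γ ∈ M := by
  have := M.add_mem h h'
  rwa [binomial, binomial, sub_add_sub_cancel] at this

theorem binomial_symm {M : Ideal (PresRing I)} {a b : Fin n →₀ ℕ} {α β : minGens I →₀ ℕ}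
    (h : binomial a b α β ∈ M) : binomial b a β α ∈ M := by
  have := M.neg_mem h
  rwa [binomial, neg_sub] at this

/-! ### Reduction to linear and fiber binomials. -/

/-- Among minimal generators whose product has a smaller exponent at `i` than at `j`, one has a
smaller exponent at `i` than at `j`. -/
theorem exists_lt_of_expSum_lt {α : minGens I →₀ ℕ} {i j : Fin n}
    (h : expSum I α i < expSum I α j) : ∃ u ∈ α.support, u.1 i < u.1 j := by
  by_contra! hc
  have happ : ∀ k, expSum I α k = ∑ u ∈ α.support, α u * u.1 k := fun k => by
    simp [expSum, Finsupp.weight_apply, Finsupp.sum, Finsupp.finsetSum_apply]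
  rw [happ, happ] at h
  exact absurd h (not_lt.mpr (Finset.sum_le_sum fun u hu => Nat.mul_le_mul_left _ (hc u hu)))

theorem exists_lt_of_degree_eq {a b : Fin n →₀ ℕ} (h : a.degree = b.degree) (hne : a ≠ b) :
    ∃ i, a i < b i := by
  by_contra! hc
  obtain ⟨c, rfl⟩ := le_iff_exists_add.mp (show b ≤ a from hc)
  rw [map_add] at h
  apply hne
  rw [(Finsupp.degree_eq_zero_iff c).mp (by omega), add_zero]

/-- Symmetric strongly shifted ideals: the binomials of `𝒦` lie in any ideal containing those
of bidegrees `(1, 1)` and `(0, k)`. -/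
theorem binomial_mem (hI : IsSymmetricStronglyShifted I) {d : ℕ}
    (hd : ∀ a ∈ minGens I, a.degree = d) {M : Ideal (PresRing I)}
    (hlin : ∀ (i j : Fin n) (u v : minGens I),
      u.1 + Finsupp.single i 1 = v.1 + Finsupp.single j 1 →
      binomial (Finsupp.single i 1) (Finsupp.single j 1)
        (Finsupp.single u 1) (Finsupp.single v 1) ∈ M)
    (hfib : ∀ α β : minGens I →₀ ℕ, expSum I α = expSum I β → α.degree = β.degree →
      binomial 0 0 α β ∈ M)
    (a b : Fin n →₀ ℕ) (α β : minGens I →₀ ℕ) (h : a + expSum I α = b + expSum I β)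
    (hdeg : α.degree = β.degree) : binomial a b α β ∈ M := by
  induction hN : a.degree using Nat.strong_induction_on generalizing a b α β with
  | _ N ih =>
  have hexp : (expSum I α).degree = (expSum I β).degree := by
    rw [degree_expSum hd, degree_expSum hd, hdeg]
  have hab : a.degree = b.degree := by
    have := congrArg Finsupp.degree h
    rw [map_add, map_add, hexp] at this
    omega
  by_cases hAB : expSum I α = expSum I β
  · obtain rfl : a = b := by rw [hAB] at h; exact add_right_cancel h
    simpa using binomial_add_mem (hfib α β hAB hdeg) a 0
  -- Quantified anew so that it also applies with the two terms swapped.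
  have step : ∀ (a b : Fin n →₀ ℕ) (α β : minGens I →₀ ℕ), a + expSum I α = b + expSum I β →
      α.degree = β.degree → a.degree = N → ∀ i j, 0 < a i → 0 < b j →
      expSum I α i < expSum I α j → binomial a b α β ∈ M := by
    intro a b α β h hdeg hN i j hi hj hij
    obtain ⟨u, hu, huij⟩ := exists_lt_of_expSum_lt hij
    obtain ⟨v, hv⟩ := exists_exchange hI hd u huij
    obtain ⟨a, rfl⟩ := le_iff_exists_add'.mp
      (show Finsupp.single i 1 ≤ a by rw [Finsupp.single_le_iff]; omega)
    obtain ⟨b, rfl⟩ := le_iff_exists_add'.mp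
      (show Finsupp.single j 1 ≤ b by rw [Finsupp.single_le_iff]; omega)
    obtain ⟨α, rfl⟩ := le_iff_exists_add'.mp
      (show Finsupp.single u 1 ≤ α by
        rw [Finsupp.single_le_iff]; have := Finsupp.mem_support_iff.mp hu; omega)
    -- After `x_i T_u` becomes `x_j T_v`, both terms are divisible by `x_j`; cancelling it lowers
    -- the degree to `N - 1`.
    refine binomial_trans (binomial_add_mem (hlin i j u v hv) a α) ?_
    rw [add_comm a, add_comm b]
    have hrec : binomial a b (α + Finsupp.single v 1) β ∈ M := by
      refine ih a.degree ?_ a b _ β ?_ ?_ rfl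
      · rw [map_add, Finsupp.degree_single] at hN
        omega
      · simp only [map_add, expSum_single, one_smul] at h ⊢
        apply add_right_cancel (b := Finsupp.single j 1)
        calc a + (expSum I α + v.1) + Finsupp.single j 1
            = a + expSum I α + (v.1 + Finsupp.single j 1) := by abel
          _ = a + Finsupp.single i 1 + (expSum I α + u.1) := by rw [← hv]; abel
          _ = _ := by rw [h]; abel
      · simpa using hdeg
    simpa only [zero_add] using binomial_add_mem hrec (Finsupp.single j 1) 0
  obtain ⟨i, hi⟩ := exists_lt_of_degree_eq hexp hAB
  obtain ⟨j, hj⟩ := exists_lt_of_degree_eq hexp.symm (Ne.symm hAB)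
  have hai := DFunLike.congr_fun h i
  have hbj := DFunLike.congr_fun h j
  simp only [Finsupp.add_apply] at hai hbj
  by_cases hij : expSum I α i < expSum I α j
  · exact step a b α β h hdeg hN i j (by omega) (by omega) hij
  -- Here `β` has the smaller exponent at `j` than at `i`, by comparison through `α`.
  · exact binomial_symm (step b a β α h.symm hdeg.symm (by omega) j i (by omega) (by omega)
      (by omega))

/-! ### The inclusion `ℒ + 𝒥 S ⊆ 𝒦`. -/

/-- The linear map `I → It` extends to the symmetric algebra, so `φ` factors through `φ'`. -/
theorem symIdeal_le_reesIdeal : symIdeal I ≤ reesIdeal I := by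
  let ℓ : I →ₗ[MvPolynomial (Fin n) K] reesAlgebra I :=
    ((Polynomial.monomial 1).comp I.subtype).codRestrict
      (Subalgebra.toSubmodule (reesAlgebra I))
      (fun x => reesAlgebra.monomial_mem.mpr (by simp))
  have h : (SymmetricAlgebra.lift ℓ).comp (toSym I) = toRees I := by
    apply MvPolynomial.algHom_ext
    intro u
    simp only [AlgHom.comp_apply, toSym, toRees, aeval_X, SymmetricAlgebra.lift_ι_apply]
    rfl
  intro f hf
  have hf' : toSym I f = 0 := hf
  change toRees I f = 0
  rw [← h, AlgHom.comp_apply, hf', map_zero]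

theorem IsMonomialIdeal.le_pow_idealOfVars (hI : IsMonomialIdeal I) {d : ℕ}
    (hd : ∀ a ∈ minGens I, a.degree = d) : I ≤ idealOfVars (Fin n) K ^ d := by
  obtain ⟨A, hA⟩ := hI
  rw [hA, Ideal.span_le]
  rintro _ ⟨a, ha, rfl⟩
  refine (monomial_mem_pow_idealOfVars_iff _ _ one_ne_zero).mpr (le_degree_of_monomial_mem hd ?_)
  rw [hA]
  exact Ideal.subset_span ⟨a, ha, rfl⟩

theorem coeff_mem_pow_of_mem_maxIdealRees {d : ℕ} (hd : I ≤ idealOfVars (Fin n) K ^ d)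
    {z : reesAlgebra I} (hz : z ∈ maxIdealRees I) (k : ℕ) :
    (z : Polynomial (MvPolynomial (Fin n) K)).coeff k ∈ idealOfVars (Fin n) K ^ (d * k + 1) := by
  have hI : ∀ k, I ^ k ≤ idealOfVars (Fin n) K ^ (d * k) := fun k => by
    rw [pow_mul]
    exact Ideal.pow_right_mono hd k
  unfold maxIdealRees Ideal.map at hz
  induction hz using Submodule.span_induction generalizing k with
  | mem z hz =>
    obtain ⟨x, hx, rfl⟩ := hz
    rw [Subalgebra.coe_algebraMap, ← Polynomial.C_eq_algebraMap, Polynomial.coeff_C]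
    split_ifs with h
    · simpa [h] using hx
    · exact Ideal.zero_mem _
  | zero => simp
  | add y z _ _ hy hz => simpa using Ideal.add_mem _ (hy k) (hz k)
  | smul r z _ hz =>
    rw [smul_eq_mul, Subalgebra.coe_mul, Polynomial.coeff_mul]
    refine Ideal.sum_mem _ fun p hp => ?_
    rw [← Finset.HasAntidiagonal.mem_antidiagonal.mp hp, mul_add, add_assoc, pow_add]
    exact Ideal.mul_mem_mul (hI _ (r.2 _)) (hz _)

theorem isHomogeneous_coeff_toRees_map_C {d : ℕ} (hd : ∀ a ∈ minGens I, a.degree = d)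
    (f : MvPolynomial (minGens I) K) (k : ℕ) :
    ((toRees I (MvPolynomial.map C f) : reesAlgebra I) :
      Polynomial (MvPolynomial (Fin n) K)).coeff k |>.IsHomogeneous (d * k) := by
  induction f using MvPolynomial.induction_on' with
  | add p q hp hq =>
    rw [map_add, map_add, Subalgebra.coe_add, Polynomial.coeff_add]
    exact hp.add hq
  | monomial α c =>
    rw [map_monomial, C_apply, toRees_monomial, Polynomial.coeff_monomial]
    split_ifs with h
    · exact isHomogeneous_monomial _ (by rw [zero_add, degree_expSum hd, h])
    · exact isHomogeneous_zero _ _ _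

/-- For `f ∈ 𝒥` the `t^k`-coefficient of the image is homogeneous of degree `dk`, yet lies in the
power `dk + 1` of the maximal ideal, so it vanishes. -/
theorem map_fiberIdeal_le_reesIdeal (hI : IsMonomialIdeal I) {d : ℕ}
    (hd : ∀ a ∈ minGens I, a.degree = d) :
    (fiberIdeal I).map (MvPolynomial.map (σ := minGens I) (C : K →+* MvPolynomial (Fin n) K)) ≤
      reesIdeal I := by
  rw [Ideal.map_le_iff_le_comap]
  intro f hf
  have hmem : toRees I (MvPolynomial.map C f) ∈ maxIdealRees I :=
    Ideal.Quotient.eq_zero_iff_mem.mp hf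
  change toRees I (MvPolynomial.map C f) = 0
  apply Subtype.ext
  refine Polynomial.ext fun k => ?_
  have h1 := coeff_mem_pow_of_mem_maxIdealRees (hI.le_pow_idealOfVars hd) hmem k
  have h2 := isHomogeneous_coeff_toRees_map_C hd f k
  rw [mem_pow_idealOfVars_iff'] at h1
  refine MvPolynomial.ext _ _ fun m => ?_
  rcases eq_or_ne m.degree (d * k) with hm | hm
  · simpa using h1 m (by omega)
  · simpa using h2.coeff_eq_zero hm

/-! ### Membership and bidegrees of the two families. -/

/-- `x_i x^u` and `x_j x^v` are one element of `I`, and `ι` is `R`-linear. -/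
theorem linear_binomial_mem_symIdeal {i j : Fin n} {u v : minGens I}
    (h : u.1 + Finsupp.single i 1 = v.1 + Finsupp.single j 1) :
    binomial (Finsupp.single i 1) (Finsupp.single j 1)
        (Finsupp.single u 1) (Finsupp.single v 1) ∈ symIdeal I := by
  have hX : ∀ (i : Fin n) (u : minGens I), toSym I
      (monomial (Finsupp.single u 1) (monomial (Finsupp.single i 1) 1)) =
      SymmetricAlgebra.ι (MvPolynomial (Fin n) K) I
        ((X i : MvPolynomial (Fin n) K) • ⟨monomial u.1 (1 : K), monomial_mem_of_minGens u⟩) := by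
    intro i u
    rw [map_smul, toSym, aeval_monomial, Algebra.smul_def]
    simp [X]
  change toSym I _ = 0
  rw [binomial, map_sub, hX, hX, sub_eq_zero]
  congr 1
  apply Subtype.ext
  simp only [SetLike.mk_smul_mk, smul_eq_mul, X, monomial_mul]
  rw [add_comm, h, add_comm]

theorem fiber_binomial_mem {α β : minGens I →₀ ℕ} (h : expSum I α = expSum I β)
    (hdeg : α.degree = β.degree) : binomial 0 0 α β ∈
      (fiberIdeal I).map
        (MvPolynomial.map (σ := minGens I) (C : K →+* MvPolynomial (Fin n) K)) := by
  have hmap : MvPolynomial.map (C : K →+* MvPolynomial (Fin n) K)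
      (monomial α 1 - monomial β 1) = binomial 0 0 α β := by
    simp [binomial, map_monomial]
  rw [← hmap]
  refine Ideal.mem_map_of_mem _ ?_
  change Ideal.Quotient.mk (maxIdealRees I) (toRees I (MvPolynomial.map C _)) = 0
  rw [hmap, toRees_binomial (by rw [h]) hdeg, map_zero]

theorem isBihomogeneous_binomial {a b : Fin n →₀ ℕ} {α β : minGens I →₀ ℕ} {d k : ℕ}
    (ha : a.degree = d) (hb : b.degree = d) (hα : α.degree = k) (hβ : β.degree = k) :
    IsBihomogeneous (binomial a b α β) d k := by
  classical
  refine ⟨(isHomogeneous_monomial _ hα).sub (isHomogeneous_monomial _ hβ), fun m => ?_⟩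
  rw [binomial, coeff_sub, coeff_monomial, coeff_monomial]
  refine IsHomogeneous.sub ?_ ?_
  · split_ifs
    exacts [isHomogeneous_monomial _ ha, isHomogeneous_zero _ _ _]
  · split_ifs
    exacts [isHomogeneous_monomial _ hb, isHomogeneous_zero _ _ _]

end SSSI

theorem theorem6p2 {K : Type*} [Field K] {n : ℕ} (I : Ideal (MvPolynomial (Fin n) K))
    (hI : SSSI.IsSymmetricStronglyShifted I) (hgen : SSSI.IsEquigenerated I) :
    SSSI.IsFiberType I ∧
      SSSI.reesIdeal I =
        Ideal.span {f | f ∈ SSSI.reesIdeal I ∧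
          ((∃ k : ℕ, SSSI.IsBihomogeneous f 0 k) ∨ SSSI.IsBihomogeneous f 1 1)} := by
  obtain ⟨d, hd⟩ := hgen
  constructor
  · apply le_antisymm
    · exact SSSI.reesIdeal_le_of_binomial_mem (SSSI.binomial_mem hI hd
        (fun i j u v h => Ideal.mem_sup_left (SSSI.linear_binomial_mem_symIdeal h))
        (fun α β h hdeg => Ideal.mem_sup_right (SSSI.fiber_binomial_mem h hdeg)))
    · exact sup_le SSSI.symIdeal_le_reesIdeal
        (SSSI.map_fiberIdeal_le_reesIdeal hI.isMonomialIdeal hd)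
  · apply le_antisymm
    · refine SSSI.reesIdeal_le_of_binomial_mem (SSSI.binomial_mem hI hd ?_ ?_)
      · intro i j u v h
        exact Ideal.subset_span ⟨SSSI.toRees_binomial
          (by simpa [add_comm] using h) (by simp), Or.inr
          (SSSI.isBihomogeneous_binomial (by simp) (by simp) (by simp) (by simp))⟩
      · intro α β h hdeg
        exact Ideal.subset_span ⟨SSSI.toRees_binomial (by rw [h]) hdeg, Or.inl ⟨α.degree,
          SSSI.isBihomogeneous_binomial (by simp) (by simp) rfl hdeg.symm⟩⟩
    · exact Ideal.span_le.mpr fun f hf => hf.1
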